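/- Let $s\ge 0$, $M\ge 1$, $L\ge 1$, $N=2^L$, and let $f_1,\dots,f_M$ be square-integrable probability density functions on $\mathbb R^s$ that are linearly independent as elements of $L^2(\mathbb R^s)$. For $k\ge 1$ let $\triangle^{k-1}\subset\mathbb R^{k}$ be the probability simplex, with the measure $A\mapsto\lambda(p(A))$, where $p$ drops the last coordinate and $\lambda$ is Lebesgue measure on $\mathbb R^{k-1}$. For a tensor $\mathcal A\in(\mathbb R^M)^{\otimes N}$ write $$P_{\mathcal A}(x_1,\dots,x_N)=\sum_{d_1,\dots,d_N=1}^M \mathcal A_{d_1,\dots,d_N}\prod_{i=1}^N f_{d_i}(x_i),\qquad x_i\in\mathbb R^s .$$ *Deep (HT) simplex-constrained ConvAC.* Let $r_0,\dots,r_{L-1}\ge 1$ be arbitrary channel numbers, and put $r_{-1}:=M$, $r_L:=1$. The parameters are vectors $\mathbf a^{l,j,\gamma}\in\triangle^{r_{l-1}-1}$ for $0\le l\le L$, $1\le j\le N/2^l$, $1\le\gamma\le r_l$. Put $\phi^{0,j,\gamma}=\mathbf a^{0,j,\gamma}$ and $\phi^{l,j,\gamma}=\sum_{\alpha=1}^{r_{l-1}}a^{l,j,\gamma}_\alpha\,\phi^{l-1,2j-1,\alpha}\otimes\phi^{l-1,2j,\alpha}$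 for $1\le l\le L$. The network with parameters $\theta$ realizes the density $P_{\mathcal A(\theta)}$, where $\mathcal A(\theta)=\phi^{L,1,1}$. With parameter sharing, $\mathbf a^{l,j,\gamma}=\mathbf a^{l,\gamma}$ does not depend on $j$. In both cases the parameter space carries the product of the simplex measures. *Shallow (CP) simplex-constrained ConvAC with $Z$ channels.* It realizes $P_{\mathcal B}$ with $\mathcal B=\sum_{z=1}^Z a_z\,\mathbf v^{z,1}\otimes\cdots\otimes\mathbf v^{z,N}$, where $\mathbf a\in\triangle^{Z-1}$ and $\mathbf v^{z,i}\in\triangle^{M-1}$. Let the parameters $\theta$ of the deep network be drawn from any probability distribution that is absolutely continuous with respect to the measure on its parameter space, with or without parameter sharing. Then, with probability $1$: 1. every shallow network whose density equals $P_{\mathcal A(\theta)}$ almost everywhere has at least $\min\{r_0,M\}^{N/2}$ channels; 2. there is $\varepsilon>0$ (depending on $\theta$) such that every shallow network whose density has $L^2$ distance less than $\varepsilon$ from $P_{\mathcal A(\theta)}$ has at least $\min\{r_0,M\}^{N/2}$ channels. In particular, if $\min\{r_0,M\}\ge 2$, then, even when the deep network has size polynomial in $N$, almost surely a shallow network needs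 at least $2^{N/2}$ channels, hence exponential size, to realize or to approximate arbitrarily well in $L^2$ the distribution realized by the deep network. -/

import Mathlib

open MeasureTheory
open scoped ENNReal

namespace ConvAC

/-- The measure of the simplex with `k` coordinates: a set `A` of points of the simplex has measure
`λ (p(A))`, where `p` drops the last coordinate and `λ` is Lebesgue measure on `ℝ^(k-1)`. -/
noncomputable def simplexMeasure (k : ℕ) : Measure (stdSimplex ℝ (Fin k)) :=
  Measure.comap
    (fun (x : stdSimplex ℝ (Fin k)) (i : Fin (k - 1)) =>
      (x : Fin k → ℝ) (Fin.castLE (Nat.sub_le k 1) i))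
    volume

/-- Numbers of channels `M, r₀, …, r_{L-1}, 1` of a deep network with `L` levels: the weight
vectors of level `l` have `width M r L l` entries, and level `l` has `width M r L (l + 1)` output
channels. -/
def width (M : ℕ) (r : ℕ → ℕ) (L : ℕ) : ℕ → ℕ
  | 0 => M
  | l + 1 => if l < L then r l else 1

/-- Indices `(l, j, γ)` of the weight vectors of a deep network on `2 ^ L` inputs without parameter
sharing: level `l ≤ L`, location `j < 2 ^ (L - l)` and output channel `γ`. The index `l = L` stands
for the single top-level weight vector. -/
abbrev DeepIndex (M : ℕ) (r : ℕ → ℕ) (L : ℕ) : Type :=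
  Σ l : Fin (L + 1), Fin (2 ^ (L - (l : ℕ))) × Fin (width M r L ((l : ℕ) + 1))

/-- Indices `(l, γ)` of the weight vectors of a deep network with parameter sharing. -/
abbrev SharedIndex (M : ℕ) (r : ℕ → ℕ) (L : ℕ) : Type :=
  Σ l : Fin (L + 1), Fin (width M r L ((l : ℕ) + 1))

/-- Parameters of a deep network without sharing: a point of the simplex for every index. -/
abbrev DeepParams (M : ℕ) (r : ℕ → ℕ) (L : ℕ) : Type :=
  ∀ i : DeepIndex M r L, stdSimplex ℝ (Fin (width M r L (i.1 : ℕ)))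

/-- Parameters of a deep network with sharing. -/
abbrev SharedParams (M : ℕ) (r : ℕ → ℕ) (L : ℕ) : Type :=
  ∀ i : SharedIndex M r L, stdSimplex ℝ (Fin (width M r L (i.1 : ℕ)))

/-- The product of the simplex measures on the parameter space without sharing. -/
noncomputable def deepMeasure (M : ℕ) (r : ℕ → ℕ) (L : ℕ) : Measure (DeepParams M r L) :=
  Measure.pi fun i => simplexMeasure (width M r L (i.1 : ℕ))

/-- The product of the simplex measures on the parameter space with sharing. -/
noncomputable def sharedMeasure (M : ℕ) (r : ℕ → ℕ) (L : ℕ) : Measure (SharedParams M r L) :=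
  Measure.pi fun i => simplexMeasure (width M r L (i.1 : ℕ))

/-- Shared parameters, used at every location. -/
def SharedParams.unshare {M : ℕ} {r : ℕ → ℕ} {L : ℕ} (θ : SharedParams M r L) :
    DeepParams M r L :=
  fun i => θ ⟨i.1, i.2.2⟩

theorem two_mul_lt {L l : ℕ} (hl : l + 1 ≤ L) (j : Fin (2 ^ (L - (l + 1)))) :
    2 * (j : ℕ) + 1 < 2 ^ (L - l) := by
  have h : L - l = (L - (l + 1)) + 1 := by omega
  have := j.2
  rw [h, pow_succ]
  omega

/-- Left child of location `j`. -/
def leftChild {L l : ℕ} (hl : l + 1 ≤ L) (j : Fin (2 ^ (L - (l + 1)))) : Fin (2 ^ (L - l)) :=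
  ⟨2 * j, by have := two_mul_lt hl j; omega⟩

/-- Right child of location `j`. -/
def rightChild {L l : ℕ} (hl : l + 1 ≤ L) (j : Fin (2 ^ (L - (l + 1)))) : Fin (2 ^ (L - l)) :=
  ⟨2 * j + 1, two_mul_lt hl j⟩

/-- First half of the modes of a tensor of order `2 ^ (l + 1)`. -/
def firstHalf {l : ℕ} (i : Fin (2 ^ l)) : Fin (2 ^ (l + 1)) :=
  ⟨i, by have := i.2; rw [pow_succ]; omega⟩

/-- Second half of the modes of a tensor of order `2 ^ (l + 1)`. -/
def secondHalf {l : ℕ} (i : Fin (2 ^ l)) : Fin (2 ^ (l + 1)) :=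
  ⟨2 ^ l + i, by have := i.2; rw [pow_succ]; omega⟩

/-- The tensors `φ^{l,j,γ}` of order `2 ^ l` of the hierarchical Tucker decomposition:
`φ^{0,j,γ} = a^{0,j,γ}` and
`φ^{l+1,j,γ} = ∑_α a^{l+1,j,γ}_α • φ^{l,left j,α} ⊗ φ^{l,right j,α}`. -/
noncomputable def htNode {M : ℕ} {r : ℕ → ℕ} {L : ℕ} (θ : DeepParams M r L) :
    (l : ℕ) → (hl : l ≤ L) → Fin (2 ^ (L - l)) → Fin (width M r L (l + 1)) →
      (Fin (2 ^ l) → Fin M) → ℝ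
  | 0, _, j, γ, d => (θ ⟨⟨0, Nat.succ_pos L⟩, j, γ⟩ : Fin M → ℝ) (d 0)
  | l + 1, hl, j, γ, d =>
      ∑ α : Fin (width M r L (l + 1)),
        (θ ⟨⟨l + 1, Nat.lt_succ_of_le hl⟩, j, γ⟩ : Fin (width M r L (l + 1)) → ℝ) α *
          (htNode θ l (Nat.le_of_succ_le hl) (leftChild hl j) α (fun i => d (firstHalf i)) *
           htNode θ l (Nat.le_of_succ_le hl) (rightChild hl j) α (fun i => d (secondHalf i)))

/-- The prior tensor (of order `2 ^ L` and dimension `M` in each mode) of the deep network: the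
tensor at the root of the tree. -/
noncomputable def htTensor {M : ℕ} {r : ℕ → ℕ} {L : ℕ} (θ : DeepParams M r L)
    (d : Fin (2 ^ L) → Fin M) : ℝ :=
  htNode θ L le_rfl ⟨0, by positivity⟩ ⟨0, by simp [width]⟩ d

/-- The prior tensor `∑_z a_z • v^{z,1} ⊗ ⋯ ⊗ v^{z,N}` of the shallow network with `Z` channels. -/
noncomputable def cpTensor {M N Z : ℕ} (a : stdSimplex ℝ (Fin Z))
    (v : Fin Z → Fin N → stdSimplex ℝ (Fin M)) (d : Fin N → Fin M) : ℝ :=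
  ∑ z, (a : Fin Z → ℝ) z * ∏ i, (v z i : Fin M → ℝ) (d i)

/-- The density realized by a network with mixing components `f` and prior tensor `A`. -/
noncomputable def modelDensity {s M N : ℕ} (f : Fin M → EuclideanSpace ℝ (Fin s) → ℝ)
    (A : (Fin N → Fin M) → ℝ) (x : Fin N → EuclideanSpace ℝ (Fin s)) : ℝ :=
  ∑ d : Fin N → Fin M, A d * ∏ i, f (d i) (x i)

/-- The distribution with mixing components `f` and prior tensor `A` needs at least `K` channels in
order to be realized (same density almost everywhere) by a shallow network, and needs at least `K`
channels in order to be approximated by shallow networks to arbitrary accuracy in `L²`. The weights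
of the shallow network are not shared, so that networks with shared weights are included. -/
def RequiresShallowChannels {s M N : ℕ} (f : Fin M → EuclideanSpace ℝ (Fin s) → ℝ)
    (A : (Fin N → Fin M) → ℝ) (K : ℕ) : Prop :=
  (∀ (Z : ℕ) (a : stdSimplex ℝ (Fin Z)) (v : Fin Z → Fin N → stdSimplex ℝ (Fin M)),
    modelDensity f (cpTensor a v) =ᵐ[volume] modelDensity f A → K ≤ Z) ∧
  ∃ ε : ℝ, 0 < ε ∧
    ∀ (Z : ℕ) (a : stdSimplex ℝ (Fin Z)) (v : Fin Z → Fin N → stdSimplex ℝ (Fin M)),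
      eLpNorm (fun x => modelDensity f (cpTensor a v) x - modelDensity f A x) 2 volume
        < ENNReal.ofReal ε → K ≤ Z

end ConvAC

/-! Pair the modes `2i` and `2i + 1`, which meet at the first level of the tree, and arrange the
prior tensor as a matrix with even modes as rows and odd modes as columns. A shallow network with
`Z` channels gives a matrix of rank at most `Z` (`le_channels_of_det_ne_zero`). With `m = min (r 0)
M`, keep the `m ^ (N/2)` rows and columns whose indices are all below `m`; it remains to see that
the determinant of this block is almost surely nonzero for the deep tensor.

That determinant is a polynomial in the weights, hence analytic in the free simplex coordinates, so
it vanishes only on a null set unless it vanishes identically (`ae_ne_zero_pi_simplexMeasure`). One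
parameter with a diagonal, invertible block rules that out (`htNode_diagonalParams`). Since it uses
shared weights, it serves both settings.

For approximation, linear independence lets the `L²` norm of a density control every tensor entry
(`exists_abs_entry_le`), and a nonzero determinant survives small changes of the entries. -/

namespace ConvAC

open scoped ContDiff

/-! ### Zero sets of analytic functions and the simplex measure -/

/-- A real analytic function on a finite-dimensional space that does not vanish at some point is
nonzero almost everywhere. -/
theorem ae_ne_zero_of_contDiff_omega {E : Type*} [NormedAddCommGroup E] [NormedSpace ℝ E]
    [FiniteDimensional ℝ E] [MeasurableSpace E] [BorelSpace E] (μ : Measure E)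
    [μ.IsAddHaarMeasure] {F : E → ℝ} (hF : ContDiff ℝ ω F) {x₀ : E} (hx₀ : F x₀ ≠ 0) :
    ∀ᵐ x ∂μ, F x ≠ 0 := by
  have hcont : Continuous fun p : E × ℝ => F (x₀ + p.2 • p.1) := by
    have := hF.continuous
    fun_prop
  have hmeas : MeasurableSet {p : E × ℝ | F (x₀ + p.2 • p.1) ≠ 0} :=
    (isOpen_ne.preimage hcont).measurableSet
  -- On each line through `x₀` the function is analytic in one variable and nonzero at `t = 0`, so
  -- its zeros are isolated.
  have hline : ∀ x : E, ∀ᵐ t : ℝ, F (x₀ + t • x) ≠ 0 := by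
    intro x
    have hG : ContDiff ℝ ω fun t : ℝ => F (x₀ + t • x) := hF.comp (by fun_prop)
    have h := (hG.analyticOnNhd (s := Set.univ)).preimage_zero_mem_codiscrete (x := 0)
      (by simpa using hx₀)
    have h2 := ae_restrict_le_codiscreteWithin (μ := (volume : Measure ℝ)) MeasurableSet.univ h
    rw [Measure.restrict_univ] at h2
    exact h2
  -- Fubini exchanges the quantifiers; a single `t ≠ 0` then suffices, because dilation by `t`
  -- preserves null sets.
  have h1 : ∀ᵐ t : ℝ, ∀ᵐ x ∂μ, F (x₀ + t • x) ≠ 0 :=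
    (Measure.ae_ae_comm hmeas).1 (Filter.Eventually.of_forall hline)
  obtain ⟨t, ht, ht0⟩ : ∃ t : ℝ, (∀ᵐ x ∂μ, F (x₀ + t • x) ≠ 0) ∧ t ≠ 0 :=
    (h1.and (Measure.ae_ne volume (0 : ℝ))).exists
  have h2 : ∀ᵐ x ∂μ, F (x₀ + x) ≠ 0 := by
    rw [ae_iff] at ht ⊢
    have h3 := Measure.addHaar_preimage_smul μ ht0 {x | ¬ F (x₀ + x) ≠ 0}
    rw [Set.preimage_ofPred_eq, ht] at h3
    have h4 : ENNReal.ofReal |(t ^ Module.finrank ℝ E)⁻¹| ≠ 0 := by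
      simp [ht0]
    exact (mul_eq_zero.1 h3.symm).resolve_left h4
  have h3 := (measurePreserving_add_left μ (-x₀)).quasiMeasurePreserving.ae h2
  simpa using h3

/-- The coordinates of a point of the simplex without the last one. -/
def dropLast {k : ℕ} (x : stdSimplex ℝ (Fin k)) (i : Fin (k - 1)) : ℝ :=
  (x : Fin k → ℝ) (Fin.castLE (Nat.sub_le k 1) i)

/-- Recover the last barycentric coordinate. -/
noncomputable def addLast {k : ℕ} (x : Fin (k - 1) → ℝ) (α : Fin k) : ℝ :=
  if h : (α : ℕ) < k - 1 then x ⟨α, h⟩ else 1 - ∑ i, x i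

theorem addLast_dropLast {k : ℕ} (x : stdSimplex ℝ (Fin k)) :
    addLast (dropLast x) = (x : Fin k → ℝ) := by
  obtain _ | k := k
  · ext i; exact i.elim0
  ext i
  unfold addLast
  split_ifs with h
  · rfl
  · have hi : i = Fin.last k := by
      apply Fin.ext
      have := i.2
      simp only [Fin.val_last]
      omega
    have hs : ∑ j : Fin (k + 1), (x : Fin (k + 1) → ℝ) j = 1 := x.2.2
    rw [Fin.sum_univ_castSucc] at hs
    subst hi
    rw [sub_eq_iff_eq_add', ← hs]
    rfl

theorem contDiff_addLast {k : ℕ} (α : Fin k) :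
    ContDiff ℝ ω fun x : Fin (k - 1) → ℝ => addLast x α := by
  unfold addLast
  split_ifs <;> fun_prop

theorem measurableEmbedding_dropLast (k : ℕ) :
    MeasurableEmbedding (dropLast : stdSimplex ℝ (Fin k) → Fin (k - 1) → ℝ) := by
  have hc : Continuous (dropLast : stdSimplex ℝ (Fin k) → Fin (k - 1) → ℝ) :=
    continuous_pi fun i => (continuous_apply _).comp continuous_subtype_val
  have hi : Function.Injective (dropLast : stdSimplex ℝ (Fin k) → Fin (k - 1) → ℝ) :=
    fun x y h => DFunLike.coe_injective (by rw [← addLast_dropLast x, ← addLast_dropLast y, h])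
  exact (hc.isClosedEmbedding hi).measurableEmbedding

theorem simplexMeasure_eq (k : ℕ) : simplexMeasure k = Measure.comap dropLast volume := rfl

/-- The image of the simplex lies in the unit cube. Finiteness supplies the sigma-finiteness that
product measures need. -/
instance isFiniteMeasure_simplexMeasure (k : ℕ) : IsFiniteMeasure (simplexMeasure k) := by
  refine ⟨?_⟩
  rw [simplexMeasure_eq, (measurableEmbedding_dropLast k).comap_apply]
  refine lt_of_le_of_lt (measure_mono (?_ : _ ⊆ Set.Icc (0 : Fin (k - 1) → ℝ) 1)) ?_
  · rintro _ ⟨x, -, rfl⟩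
    exact ⟨fun i => x.2.1 _, fun i => (mem_Icc_of_mem_stdSimplex x.2 _).2⟩
  · exact isCompact_Icc.measure_lt_top

theorem measurePreserving_dropLast (k : ℕ) :
    MeasurePreserving dropLast (simplexMeasure k)
      (volume.restrict (Set.range (dropLast : stdSimplex ℝ (Fin k) → _))) :=
  ⟨(measurableEmbedding_dropLast k).measurable, by
    rw [simplexMeasure_eq, (measurableEmbedding_dropLast k).map_comap]⟩

/-- Dropping the last coordinates of a family of points of simplices maps the product of the simplex
measures to a measure that is absolutely continuous. -/
theorem quasiMeasurePreserving_pi_dropLast {ι : Type*} [Fintype ι] (k : ι → ℕ) :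
    Measure.QuasiMeasurePreserving
      (fun (θ : ∀ i, stdSimplex ℝ (Fin (k i))) i => dropLast (θ i))
      (Measure.pi fun i => simplexMeasure (k i)) volume := by
  have h := measurePreserving_pi _ _ fun i => measurePreserving_dropLast (k i)
  refine h.quasiMeasurePreserving.mono_right ?_
  rw [← Measure.restrict_pi_pi]
  exact Measure.absolutelyContinuous_of_le Measure.restrict_le_self

/-- An analytic function of barycentric coordinates that does not vanish at some family of points of
simplices is nonzero almost everywhere. -/
theorem ae_ne_zero_pi_simplexMeasure {ι : Type*} [Fintype ι] (k : ι → ℕ)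
    {F : (∀ i, Fin (k i) → ℝ) → ℝ} (hF : ContDiff ℝ ω F)
    (θ₀ : ∀ i, stdSimplex ℝ (Fin (k i))) (hθ₀ : F (fun i => (θ₀ i : Fin (k i) → ℝ)) ≠ 0) :
    ∀ᵐ θ ∂(Measure.pi fun i => simplexMeasure (k i)),
      F (fun i => (θ i : Fin (k i) → ℝ)) ≠ 0 := by
  have hG : ContDiff ℝ ω fun x : ∀ i, Fin (k i - 1) → ℝ => F fun i => addLast (x i) := by
    refine hF.comp (contDiff_pi.2 fun i => contDiff_pi.2 fun α => ?_)
    exact (contDiff_addLast α).comp (contDiff_pi.1 contDiff_id i)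
  have h := ae_ne_zero_of_contDiff_omega volume hG (x₀ := fun i => dropLast (θ₀ i))
    (by simpa only [addLast_dropLast] using hθ₀)
  have h2 := (quasiMeasurePreserving_pi_dropLast k).ae h
  simpa only [addLast_dropLast] using h2

/-! ### The deep tensor as a polynomial in its weights -/

/-- The tensors of the hierarchical Tucker decomposition with arbitrary real weights. -/
noncomputable def weightedNode {M : ℕ} {r : ℕ → ℕ} {L : ℕ}
    (w : ∀ i : DeepIndex M r L, Fin (width M r L (i.1 : ℕ)) → ℝ) :
    (l : ℕ) → (hl : l ≤ L) → Fin (2 ^ (L - l)) → Fin (width M r L (l + 1)) →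
      (Fin (2 ^ l) → Fin M) → ℝ
  | 0, _, j, γ, d => w ⟨⟨0, Nat.succ_pos L⟩, j, γ⟩ (d 0)
  | l + 1, hl, j, γ, d =>
      ∑ α : Fin (width M r L (l + 1)),
        w ⟨⟨l + 1, Nat.lt_succ_of_le hl⟩, j, γ⟩ α *
          (weightedNode w l (Nat.le_of_succ_le hl) (leftChild hl j) α (fun i => d (firstHalf i)) *
           weightedNode w l (Nat.le_of_succ_le hl) (rightChild hl j) α (fun i => d (secondHalf i)))

theorem htNode_eq_weightedNode {M : ℕ} {r : ℕ → ℕ} {L : ℕ} (θ : DeepParams M r L) (l : ℕ)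
    (hl : l ≤ L) (j : Fin (2 ^ (L - l))) (γ : Fin (width M r L (l + 1)))
    (d : Fin (2 ^ l) → Fin M) :
    htNode θ l hl j γ d = weightedNode (fun i => (θ i : Fin (width M r L (i.1 : ℕ)) → ℝ))
      l hl j γ d := by
  induction l with
  | zero => rfl
  | succ l ih => simp only [htNode, weightedNode, ih]

theorem contDiff_weightedNode {M : ℕ} {r : ℕ → ℕ} {L : ℕ} (l : ℕ)
    (hl : l ≤ L) (j : Fin (2 ^ (L - l))) (γ : Fin (width M r L (l + 1)))
    (d : Fin (2 ^ l) → Fin M) :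
    ContDiff ℝ ω fun w : ∀ i : DeepIndex M r L, Fin (width M r L (i.1 : ℕ)) → ℝ =>
      weightedNode w l hl j γ d := by
  induction l with
  | zero =>
    simp only [weightedNode]
    exact contDiff_pi.1 (contDiff_pi.1 contDiff_id _) _
  | succ l ih =>
    simp only [weightedNode]
    exact ContDiff.sum fun α _ =>
      (contDiff_pi.1 (contDiff_pi.1 contDiff_id _) _).mul ((ih _ _ _ _).mul (ih _ _ _ _))

/-! ### Even-odd matricization and a diagonal example -/

/-- The multi-index with entries `x` in the even modes and `y` in the odd modes. -/
def interleave {M m n : ℕ} (h : m ≤ M) (x y : Fin (2 ^ n) → Fin m) (i : Fin (2 ^ (n + 1))) :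
    Fin M :=
  Fin.castLE h (if (i : ℕ) % 2 = 0
    then x ⟨(i : ℕ) / 2, by have := i.2; have := pow_succ 2 n; omega⟩
    else y ⟨(i : ℕ) / 2, by have := i.2; have := pow_succ 2 n; omega⟩)

theorem interleave_firstHalf {M m n : ℕ} (h : m ≤ M) (x y : Fin (2 ^ (n + 1)) → Fin m) :
    (fun i => interleave h x y (firstHalf i)) =
      interleave h (fun i => x (firstHalf i)) (fun i => y (firstHalf i)) := rfl

/-- The second half starts at the even offset `2 ^ (n + 1)`, so the shift preserves parity. -/
theorem interleave_secondHalf {M m n : ℕ} (h : m ≤ M) (x y : Fin (2 ^ (n + 1)) → Fin m) :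
    (fun i => interleave h x y (secondHalf i)) =
      interleave h (fun i => x (secondHalf i)) (fun i => y (secondHalf i)) := by
  funext i
  have h1 : (2 ^ (n + 1) + (i : ℕ)) % 2 = (i : ℕ) % 2 := by have := pow_succ 2 n; omega
  have h2 : (2 ^ (n + 1) + (i : ℕ)) / 2 = 2 ^ n + (i : ℕ) / 2 := by have := pow_succ 2 n; omega
  simp only [interleave, secondHalf, h1, h2]

theorem eq_iff_halves_eq {m n : ℕ} (x y : Fin (2 ^ (n + 1)) → Fin m) :
    x = y ↔ (fun i : Fin (2 ^ n) => x (firstHalf i)) = (fun i => y (firstHalf i)) ∧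
      (fun i : Fin (2 ^ n) => x (secondHalf i)) = (fun i => y (secondHalf i)) := by
  refine ⟨by rintro rfl; exact ⟨rfl, rfl⟩, fun ⟨h1, h2⟩ => funext fun i => ?_⟩
  by_cases hi : (i : ℕ) < 2 ^ n
  · exact congrFun h1 ⟨i, hi⟩
  · have hlt : (i : ℕ) - 2 ^ n < 2 ^ n := by
      have := i.2
      have := pow_succ 2 n
      omega
    have he : (secondHalf ⟨(i : ℕ) - 2 ^ n, hlt⟩ : Fin (2 ^ (n + 1))) = i := by
      apply Fin.ext
      simp only [secondHalf]
      omega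
    have := congrFun h2 ⟨(i : ℕ) - 2 ^ n, hlt⟩
    simpa only [he] using this

/-- The submatrix of the matricization of a tensor with respect to even and odd modes whose indices
are below `m` in each mode. -/
def pairMatrix {M m n : ℕ} (h : m ≤ M) (A : (Fin (2 ^ (n + 1)) → Fin M) → ℝ) :
    Matrix (Fin (2 ^ n) → Fin m) (Fin (2 ^ n) → Fin m) ℝ :=
  Matrix.of fun x y => A (interleave h x y)

/-- Shared parameters with one-hot vectors at the bottom level and uniform weights elsewhere. -/
noncomputable def diagonalParams {M : ℕ} (hM : 0 < M) {r : ℕ → ℕ} {L : ℕ} (hr : ∀ l < L, 0 < r l) :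
    SharedParams M r L
  -- Truncation by `M - 1` covers `r 0 > M`: the surplus channels repeat the last basis vector.
  | ⟨⟨0, _⟩, γ⟩ => ⟨Pi.single (⟨min (γ : ℕ) (M - 1), by omega⟩ : Fin M) 1,
      single_mem_stdSimplex ℝ _⟩
  | ⟨⟨l + 1, hl⟩, _⟩ => ⟨fun _ => ((width M r L (l + 1) : ℕ) : ℝ)⁻¹, by
      have h : 0 < width M r L (l + 1) := by
        have hl' := Nat.lt_of_succ_lt_succ hl
        simpa only [width, if_pos hl'] using hr l hl'
      refine ⟨fun _ => by positivity, ?_⟩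
      simp [h.ne']⟩

/-- A first-level node is a positive combination of tensors `e ⊗ e` with `e` a basis vector, so it
is supported on equal pairs of indices. Higher levels multiply such tensors over the two halves and
average with positive weights, which preserves this support. Only signs are tracked, since
invertibility needs no exact values. -/
theorem htNode_diagonalParams {M : ℕ} (hM : 0 < M) {r : ℕ → ℕ} {L m : ℕ} (hr : ∀ l < L, 0 < r l)
    (hmM : m ≤ M) (hmr : m ≤ r 0) (l : ℕ) (hl : l + 1 ≤ L) (j : Fin (2 ^ (L - (l + 1))))
    (γ : Fin (width M r L (l + 1 + 1))) (x y : Fin (2 ^ l) → Fin m) :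
    (x = y → 0 < htNode (diagonalParams hM hr).unshare (l + 1) hl j γ (interleave hmM x y)) ∧
    (x ≠ y → htNode (diagonalParams hM hr).unshare (l + 1) hl j γ (interleave hmM x y) = 0) := by
  have hw : ∀ l < L, 0 < width M r L (l + 1) := by
    intro l hl
    simpa only [width, if_pos hl] using hr l hl
  induction l with
  | zero =>
    have hL : width M r L (0 + 1) = r 0 := by simp only [width]; rw [if_pos (by omega)]
    have key : ∀ α : Fin (width M r L (0 + 1)),
        htNode (diagonalParams hM hr).unshare 0 (Nat.le_of_succ_le hl) (leftChild hl j) α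
          (fun i => interleave hmM x y (firstHalf i)) =
          (if ((x 0 : Fin m) : ℕ) = min (α : ℕ) (M - 1) then 1 else 0) ∧
        htNode (diagonalParams hM hr).unshare 0 (Nat.le_of_succ_le hl) (rightChild hl j) α
          (fun i => interleave hmM x y (secondHalf i)) =
          (if ((y 0 : Fin m) : ℕ) = min (α : ℕ) (M - 1) then 1 else 0) := by
      intro α
      constructor
      · change (Pi.single (⟨min (α : ℕ) (M - 1), _⟩ : Fin M) (1 : ℝ) : Fin M → ℝ)
          (Fin.castLE hmM (x 0)) = _
        simp only [Pi.single_apply, Fin.ext_iff, Fin.val_castLE]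
      · change (Pi.single (⟨min (α : ℕ) (M - 1), _⟩ : Fin M) (1 : ℝ) : Fin M → ℝ)
          (Fin.castLE hmM (y 0)) = _
        simp only [Pi.single_apply, Fin.ext_iff, Fin.val_castLE]
    have h0 : ∀ i : Fin (2 ^ 0), i = 0 := fun i => Subsingleton.elim (α := Fin 1) i 0
    have hpos : (0 : ℝ) < ((width M r L (0 + 1) : ℕ) : ℝ)⁻¹ := by
      have := hw 0 hl
      positivity
    have hval : htNode (diagonalParams hM hr).unshare (0 + 1) hl j γ (interleave hmM x y) =
        ∑ α : Fin (width M r L (0 + 1)), ((width M r L (0 + 1) : ℕ) : ℝ)⁻¹ *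
          ((if ((x 0 : Fin m) : ℕ) = min (α : ℕ) (M - 1) then 1 else 0) *
            (if ((y 0 : Fin m) : ℕ) = min (α : ℕ) (M - 1) then 1 else 0)) := by
      rw [htNode]
      refine Finset.sum_congr rfl fun α _ => ?_
      rw [(key α).1, (key α).2]
      rfl
    rw [hval]
    constructor
    · rintro rfl
      -- The channel numbered `x 0` exists since `x 0 < m ≤ r 0`, and is not truncated since `m ≤
      -- M`.
      refine Finset.sum_pos' (fun α _ => ?_) ⟨⟨x 0, by have := (x 0).2; omega⟩, Finset.mem_univ _, ?_⟩
      · split_ifs <;> simp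
      · have := (x 0).2
        rw [if_pos (by simp only []; omega)]
        simpa using hw 0 hl
    · intro hxy
      refine Finset.sum_eq_zero fun α _ => ?_
      split_ifs with h1 h2 <;> try simp
      exact absurd (funext fun i => by rw [h0 i]; exact Fin.ext (h1.trans h2.symm)) hxy
  | succ l ih =>
    rw [htNode]
    simp only [interleave_firstHalf, interleave_secondHalf]
    constructor
    · intro hxy
      obtain ⟨h1, h2⟩ := (eq_iff_halves_eq x y).1 hxy
      have : Nonempty (Fin (width M r L (l + 1 + 1))) := ⟨⟨0, hw _ hl⟩⟩
      refine Finset.sum_pos (fun α _ => mul_pos ?_ (mul_pos ((ih _ _ _ _ _).1 h1) ((ih _ _ _ _ _).1 h2)))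
        Finset.univ_nonempty
      change (0 : ℝ) < ((width M r L (l + 1 + 1) : ℕ) : ℝ)⁻¹
      have := hw (l + 1) hl
      positivity
    · intro hxy
      refine Finset.sum_eq_zero fun α _ => ?_
      rw [ne_eq, eq_iff_halves_eq, not_and_or] at hxy
      rcases hxy with h | h
      · rw [(ih _ _ _ _ _).2 h]; simp
      · rw [(ih _ _ _ (fun i => x (secondHalf i)) _).2 h]; simp

/-! ### Determinants and the rank bound for shallow networks -/

theorem contDiff_det {E ι : Type*} [NormedAddCommGroup E] [NormedSpace ℝ E] [Fintype ι]
    [DecidableEq ι] {F : E → Matrix ι ι ℝ} (hF : ∀ i j, ContDiff ℝ ω fun x => F x i j) :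
    ContDiff ℝ ω fun x => (F x).det := by
  simp only [Matrix.det_apply]
  refine ContDiff.sum fun σ _ => ?_
  simp only [Units.smul_def, zsmul_eq_mul]
  exact contDiff_const.mul (contDiff_prod fun i _ => hF _ _)

/-- Each channel contributes a product over even modes times a product over odd modes. The block
therefore factors through a space of dimension `Z`, while its rank is full. -/
theorem le_channels_of_det_ne_zero {M m n Z : ℕ} (h : m ≤ M) (a : stdSimplex ℝ (Fin Z))
    (v : Fin Z → Fin (2 ^ (n + 1)) → stdSimplex ℝ (Fin M))
    (hdet : (pairMatrix h (cpTensor a v)).det ≠ 0) : m ^ 2 ^ n ≤ Z := by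
  have hp := pow_succ 2 n
  let U : Matrix (Fin (2 ^ n) → Fin m) (Fin Z) ℝ := Matrix.of fun x z =>
    (a : Fin Z → ℝ) z * ∏ i : Fin (2 ^ n),
      (v z ⟨2 * i, by have := i.2; omega⟩ : Fin M → ℝ) (Fin.castLE h (x i))
  let V : Matrix (Fin Z) (Fin (2 ^ n) → Fin m) ℝ := Matrix.of fun z y =>
    ∏ i : Fin (2 ^ n), (v z ⟨2 * i + 1, by have := i.2; omega⟩ : Fin M → ℝ) (Fin.castLE h (y i))
  have hUV : pairMatrix h (cpTensor a v) = U * V := by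
    ext x y
    simp only [pairMatrix, cpTensor, Matrix.mul_apply, Matrix.of_apply, U, V]
    refine Finset.sum_congr rfl fun z _ => ?_
    rw [mul_assoc, ← Finset.prod_mul_distrib]
    congr 1
    let e : Fin (2 ^ n) × Fin 2 ≃ Fin (2 ^ (n + 1)) :=
      finProdFinEquiv.trans (finCongr hp.symm)
    rw [← e.prod_comp, Fintype.prod_prod_type]
    refine Finset.prod_congr rfl fun i _ => ?_
    rw [Fin.prod_univ_two]
    have he0 : e (i, 0) = ⟨2 * i, by have := i.2; omega⟩ := by
      apply Fin.ext
      simp [e, finProdFinEquiv]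
    have he1 : e (i, 1) = ⟨2 * i + 1, by have := i.2; omega⟩ := by
      apply Fin.ext
      simp [e, finProdFinEquiv, add_comm]
    rw [he0, he1]
    have h2 : (2 * (i : ℕ) + 1) / 2 = i := by omega
    simp [interleave, h2]
  have hrank := Matrix.rank_of_isUnit _
    ((Matrix.isUnit_iff_isUnit_det _).2 (isUnit_iff_ne_zero.2 hdet))
  rw [hUV] at hrank
  have := (Matrix.rank_mul_le_left U V).trans (Matrix.rank_le_card_width U)
  rw [hrank] at this
  simpa using this

/-! ### Recovering tensor entries from the density -/

/-- A finite linearly independent family in a Hilbert space has a dual family. -/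
theorem exists_dual_family {H ι : Type*} [NormedAddCommGroup H] [InnerProductSpace ℝ H]
    [CompleteSpace H] [Finite ι] [DecidableEq ι] {v : ι → H} (hv : LinearIndependent ℝ v) :
    ∃ w : ι → H, ∀ i j, inner ℝ (w i) (v j) = if i = j then (1 : ℝ) else 0 := by
  have hfin : FiniteDimensional ℝ (Submodule.span ℝ (Set.range v)) :=
    FiniteDimensional.span_of_finite ℝ (Set.finite_range v)
  let b := Module.Basis.span hv
  have hex : ∀ i, ∃ g : StrongDual ℝ H, ∀ j, g (v j) = if i = j then (1 : ℝ) else 0 := by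
    intro i
    -- Hahn–Banach extends the coordinate functionals from the span; Riesz representation then turns
    -- them into vectors.
    obtain ⟨g, hg, -⟩ := exists_extension_norm_eq (𝕜 := ℝ) _
      (LinearMap.toContinuousLinearMap (b.coord i))
    refine ⟨g, fun j => ?_⟩
    have hb : ((b j : Submodule.span ℝ (Set.range v)) : H) = v j :=
      congrArg Subtype.val (Module.Basis.span_apply hv j)
    rw [← hb, hg]
    simp [Module.Basis.coord_apply, Finsupp.single_apply, eq_comm]
  choose g hg using hex
  refine ⟨fun i => (InnerProductSpace.toDual ℝ H).symm (g i), fun i j => ?_⟩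
  rw [InnerProductSpace.toDual_symm_apply, hg]

theorem exists_dual_functions {X ι : Type*} [MeasurableSpace X] {μ : Measure X} [Finite ι]
    [DecidableEq ι] {f : ι → X → ℝ} (hf : ∀ i, MemLp (f i) 2 μ)
    (hv : LinearIndependent ℝ fun i => (hf i).toLp (f i)) :
    ∃ g : ι → X → ℝ, (∀ i, MemLp (g i) 2 μ) ∧
      ∀ i j, ∫ x, g i x * f j x ∂μ = if i = j then 1 else 0 := by
  obtain ⟨w, hw⟩ := exists_dual_family hv
  refine ⟨fun i => w i, fun i => Lp.memLp _, fun i j => ?_⟩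
  rw [← hw i j, L2.inner_def]
  refine integral_congr_ae ?_
  filter_upwards [(hf j).coeFn_toLp] with x hx
  rw [hx]
  simp [mul_comm]

theorem memLp_two_prod {X ι : Type*} [MeasurableSpace X] {μ : Measure X} [SigmaFinite μ]
    [Fintype ι] {f : ι → X → ℝ} (hf : ∀ i, MemLp (f i) 2 μ) :
    MemLp (fun x : ι → X => ∏ i, f i (x i)) 2 (Measure.pi fun _ => μ) := by
  have hm : AEStronglyMeasurable (fun x : ι → X => ∏ i, f i (x i)) (Measure.pi fun _ => μ) :=
    Finset.aestronglyMeasurable_fun_prod _ fun i _ =>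
      (hf i).1.comp_quasiMeasurePreserving (Measure.quasiMeasurePreserving_eval _ i)
  rw [memLp_two_iff_integrable_sq hm]
  simp only [← Finset.prod_pow]
  exact Integrable.fintype_prod fun i => (memLp_two_iff_integrable_sq (hf i).1).1 (hf i)

theorem memLp_two_modelDensity {s M N : ℕ} {f : Fin M → EuclideanSpace ℝ (Fin s) → ℝ}
    (hf : ∀ i, MemLp (f i) 2) (A : (Fin N → Fin M) → ℝ) : MemLp (modelDensity f A) 2 := by
  unfold modelDensity
  exact memLp_finsetSum _ fun d _ => (memLp_two_prod fun i => hf (d i)).const_mul _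

theorem modelDensity_sub {s M N : ℕ} (f : Fin M → EuclideanSpace ℝ (Fin s) → ℝ)
    (A B : (Fin N → Fin M) → ℝ) (x : Fin N → EuclideanSpace ℝ (Fin s)) :
    modelDensity f A x - modelDensity f B x = modelDensity f (A - B) x := by
  simp only [modelDensity, ← Finset.sum_sub_distrib, Pi.sub_apply, sub_mul]

theorem abs_integral_mul_le {X : Type*} [MeasurableSpace X] {μ : Measure X} {f g : X → ℝ}
    (hf : MemLp f 2 μ) (hg : MemLp g 2 μ) :
    |∫ x, f x * g x ∂μ| ≤ (eLpNorm f 2 μ).toReal * (eLpNorm g 2 μ).toReal := by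
  rw [← ENNReal.toReal_mul]
  have h := eLpNorm_smul_le_mul_eLpNorm (p := 2) (q := 2) (r := 1) hg.1 hf.1
  have hfin : eLpNorm f 2 μ * eLpNorm g 2 μ ≠ ⊤ :=
    ENNReal.mul_ne_top hf.eLpNorm_ne_top hg.eLpNorm_ne_top
  refine le_trans ?_ (ENNReal.toReal_mono hfin h)
  rw [eLpNorm_one_eq_lintegral_enorm, ← Real.norm_eq_abs, ← toReal_enorm]
  refine ENNReal.toReal_mono ?_ (enorm_integral_le_lintegral_enorm fun x => f x * g x)
  rw [← eLpNorm_one_eq_lintegral_enorm]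
  exact (h.trans_lt hfin.lt_top).ne

/-- The entries of the prior tensor are controlled by the `L²` norm of the density. -/
theorem exists_abs_entry_le {s M N : ℕ} {f : Fin M → EuclideanSpace ℝ (Fin s) → ℝ}
    (hf : ∀ i, MemLp (f i) 2) (hv : LinearIndependent ℝ fun i => (hf i).toLp (f i)) :
    ∃ C : ℝ, 0 < C ∧ ∀ (A : (Fin N → Fin M) → ℝ) (e : Fin N → Fin M),
      |A e| ≤ (eLpNorm (modelDensity f A) 2 volume).toReal * C := by
  obtain ⟨g, hg, hgf⟩ := exists_dual_functions hf hv
  let G : (Fin N → Fin M) → (Fin N → EuclideanSpace ℝ (Fin s)) → ℝ :=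
    fun e x => ∏ i, g (e i) (x i)
  have hG : ∀ e, MemLp (G e) 2 volume := fun e => memLp_two_prod fun i => hg (e i)
  -- Pairing with a product of dual functions factors by Fubini and isolates one entry.
  have hentry : ∀ (A : (Fin N → Fin M) → ℝ) e, ∫ x, modelDensity f A x * G e x = A e := by
    intro A e
    have hterm : ∀ (d : Fin N → Fin M), (fun x : Fin N → EuclideanSpace ℝ (Fin s) =>
        A d * (∏ i, f (d i) (x i)) * G e x) =
        fun x => A d * ∏ i, (g (e i) (x i) * f (d i) (x i)) := by
      intro d
      funext x
      simp only [G, Finset.prod_mul_distrib]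
      ring
    simp only [modelDensity, Finset.sum_mul]
    rw [integral_finsetSum]
    · simp only [hterm, integral_const_mul]
      rw [Finset.sum_eq_single e]
      · rw [integral_fintype_prod_volume_eq_prod (fun i y => g (e i) y * f (e i) y)]
        simp [hgf]
      · intro d _ hd
        rw [integral_fintype_prod_volume_eq_prod (fun i y => g (e i) y * f (d i) y)]
        obtain ⟨i, hi⟩ := Function.ne_iff.1 hd
        rw [Finset.prod_eq_zero (Finset.mem_univ i), mul_zero]
        rw [hgf, if_neg (Ne.symm hi)]
      · simp
    · intro d _
      rw [hterm]
      exact (Integrable.fintype_prod fun i => (hg (e i)).integrable_mul (hf (d i))).const_mul _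
  -- The sum bounds all the norms of the `G e` at once; the added `1` makes the constant positive.
  refine ⟨1 + ∑ e, (eLpNorm (G e) 2 volume).toReal, by positivity, fun A e => ?_⟩
  rw [← hentry A e]
  refine (abs_integral_mul_le (memLp_two_modelDensity hf A) (hG e)).trans ?_
  gcongr
  have := Finset.single_le_sum (f := fun e => (eLpNorm (G e) 2 volume).toReal)
    (fun _ _ => ENNReal.toReal_nonneg) (Finset.mem_univ e)
  linarith

/-- Nonvanishing of the determinant is an open condition on the tensor. A density within `δ / C` in
`L²` has its tensor within `δ`, so the rank bound applies to the approximating network itself. -/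
theorem requiresShallowChannels_of_det_ne_zero {s M m n : ℕ}
    {f : Fin M → EuclideanSpace ℝ (Fin s) → ℝ} (hf : ∀ i, MemLp (f i) 2)
    (hv : LinearIndependent ℝ fun i => (hf i).toLp (f i)) (h : m ≤ M)
    {A : (Fin (2 ^ (n + 1)) → Fin M) → ℝ} (hA : (pairMatrix h A).det ≠ 0) :
    RequiresShallowChannels f A (m ^ 2 ^ n) := by
  have hcont : Continuous fun B : (Fin (2 ^ (n + 1)) → Fin M) → ℝ => (pairMatrix h B).det :=
    Continuous.matrix_det (continuous_matrix fun x y => continuous_apply (interleave h x y))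
  obtain ⟨δ, hδ, hball⟩ := Metric.isOpen_iff.1 (isOpen_ne.preimage hcont) A hA
  obtain ⟨C, hC, hbound⟩ := exists_abs_entry_le (N := 2 ^ (n + 1)) hf hv
  have key : ∀ (Z : ℕ) (a : stdSimplex ℝ (Fin Z))
      (v : Fin Z → Fin (2 ^ (n + 1)) → stdSimplex ℝ (Fin M)),
      eLpNorm (fun x => modelDensity f (cpTensor a v) x - modelDensity f A x) 2 volume
        < ENNReal.ofReal (δ / C) → m ^ 2 ^ n ≤ Z := by
    intro Z a v hlt
    refine le_channels_of_det_ne_zero h a v (hball ?_)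
    rw [Metric.mem_ball, dist_pi_lt_iff hδ]
    intro e
    simp only [modelDensity_sub] at hlt
    have hlt2 := (ENNReal.lt_ofReal_iff_toReal_lt hlt.ne_top).1 hlt
    rw [Real.dist_eq, ← Pi.sub_apply]
    refine (hbound _ e).trans_lt ?_
    rwa [lt_div_iff₀ hC] at hlt2
  -- Exact realization is the case of distance zero.
  refine ⟨fun Z a v hae => key Z a v ?_, δ / C, by positivity, key⟩
  have h0 : (fun x => modelDensity f (cpTensor a v) x - modelDensity f A x) =ᵐ[volume] 0 := by
    filter_upwards [hae] with x hx
    simp [hx]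
  rw [eLpNorm_congr_ae h0, eLpNorm_zero]
  exact ENNReal.ofReal_pos.2 (by positivity)

/-! ### Almost sure nonvanishing for deep networks -/

theorem htTensor_eq_weightedNode {M : ℕ} {r : ℕ → ℕ} {L : ℕ} (θ : DeepParams M r L)
    (d : Fin (2 ^ L) → Fin M) :
    htTensor θ d = weightedNode (fun i => (θ i : Fin (width M r L (i.1 : ℕ)) → ℝ)) L le_rfl
      ⟨0, by positivity⟩ ⟨0, by simp [width]⟩ d :=
  htNode_eq_weightedNode _ _ _ _ _ _

/-- The determinant of `pairMatrix` of the prior tensor, as a function of arbitrary real weights. -/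
noncomputable def pairDet {M m n : ℕ} (h : m ≤ M) (r : ℕ → ℕ)
    (w : ∀ i : DeepIndex M r (n + 1), Fin (width M r (n + 1) (i.1 : ℕ)) → ℝ) : ℝ :=
  (pairMatrix h (weightedNode w (n + 1) le_rfl ⟨0, by positivity⟩ ⟨0, by simp [width]⟩)).det

theorem contDiff_pairDet {M m n : ℕ} (h : m ≤ M) (r : ℕ → ℕ) :
    ContDiff ℝ ω (pairDet (n := n) h r) :=
  contDiff_det fun _ _ => contDiff_weightedNode _ _ _ _ _

theorem pairDet_eq {M m n : ℕ} (h : m ≤ M) {r : ℕ → ℕ} (θ : DeepParams M r (n + 1)) :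
    pairDet h r (fun i => (θ i : Fin (width M r (n + 1) (i.1 : ℕ)) → ℝ)) =
      (pairMatrix h (htTensor θ)).det := by
  rw [pairDet, show htTensor θ = _ from funext fun d => htTensor_eq_weightedNode θ d]

theorem det_pairMatrix_diagonalParams_ne_zero {M m n : ℕ} (hM : 0 < M) {r : ℕ → ℕ}
    (hr : ∀ l < n + 1, 0 < r l) (h : m ≤ M) (hmr : m ≤ r 0) :
    (pairMatrix h (htTensor (diagonalParams hM hr).unshare)).det ≠ 0 := by
  have hd := htNode_diagonalParams hM hr h hmr n (le_refl (n + 1)) ⟨0, by positivity⟩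
    ⟨0, by simp [width]⟩
  have hdiag : pairMatrix h (htTensor (diagonalParams hM hr).unshare) =
      Matrix.diagonal fun x =>
        htTensor (diagonalParams hM hr).unshare (interleave h x x) := by
    ext x y
    rcases eq_or_ne x y with rfl | hxy
    · simp [pairMatrix]
    · rw [Matrix.diagonal_apply_ne _ hxy]
      exact (hd x y).2 hxy
  rw [hdiag, Matrix.det_diagonal]
  exact Finset.prod_ne_zero_iff.2 fun x _ => ((hd x x).1 rfl).ne'

/-- All levels of a network with nonempty parameter space have a channel. -/
theorem channels_pos {M : ℕ} {r : ℕ → ℕ} {L : ℕ} (θ : DeepParams M r L) :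
    ∀ l < L, 0 < r l := by
  -- A simplex with no coordinates is empty, so a weight vector forces positive width. Positivity
  -- descends from the top width, which is `1`.
  have hstep : ∀ l, l ≤ L → 0 < width M r L (l + 1) → 0 < width M r L l := by
    intro l hl h
    have x := θ ⟨⟨l, Nat.lt_succ_of_le hl⟩, ⟨0, by positivity⟩, ⟨0, h⟩⟩
    rcases Nat.eq_zero_or_pos (width M r L l) with h0 | h0
    · have hsum : ∑ i, (x : Fin (width M r L l) → ℝ) i = 1 := x.2.2
      have : IsEmpty (Fin (width M r L l)) := by rw [h0]; infer_instance
      simp at hsum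
    · exact h0
  have hall : ∀ l, l ≤ L + 1 → 0 < width M r L l := by
    intro l hl
    refine Nat.decreasingInduction (motive := fun l _ => 0 < width M r L l)
      (fun l hl ih => hstep l (Nat.le_of_lt_succ hl) ih) ?_ hl
    simp [width]
  intro l hl
  have := hall (l + 1) (by omega)
  simpa [width, hl] using this

theorem ae_requiresShallowChannels {s M n : ℕ} {r : ℕ → ℕ}
    {f : Fin M → EuclideanSpace ℝ (Fin s) → ℝ} (hf : ∀ i, MemLp (f i) 2)
    (hv : LinearIndependent ℝ fun i => (hf i).toLp (f i)) :
    (∀ᵐ θ ∂deepMeasure M r (n + 1),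
      RequiresShallowChannels f (htTensor θ) (min (r 0) M ^ 2 ^ n)) ∧
    (∀ᵐ θ ∂sharedMeasure M r (n + 1),
      RequiresShallowChannels f (htTensor θ.unshare) (min (r 0) M ^ 2 ^ n)) := by
  by_cases hpos : 0 < M ∧ ∀ l < n + 1, 0 < r l
  · obtain ⟨hM, hr⟩ := hpos
    have h0 := det_pairMatrix_diagonalParams_ne_zero hM hr (min_le_right (r 0) M)
      (min_le_left (r 0) M)
    rw [← pairDet_eq] at h0
    constructor
    · filter_upwards [ae_ne_zero_pi_simplexMeasure _ (contDiff_pairDet (min_le_right _ _) r) _ h0]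
        with θ hθ
      rw [pairDet_eq] at hθ
      exact requiresShallowChannels_of_det_ne_zero hf hv _ hθ
    -- Sharing repeats coordinates, a linear substitution, so the determinant stays analytic.
    · have hF : ContDiff ℝ ω
          fun w : ∀ i : SharedIndex M r (n + 1), Fin (width M r (n + 1) (i.1 : ℕ)) → ℝ =>
            pairDet (min_le_right (r 0) M) r fun i => w ⟨i.1, i.2.2⟩ :=
        (contDiff_pairDet (min_le_right _ _) r).comp
          (contDiff_pi.2 fun i => contDiff_pi.1 contDiff_id _)
      filter_upwards [ae_ne_zero_pi_simplexMeasure _ hF (diagonalParams hM hr) h0] with θ hθ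
      have hθ2 := hθ
      change pairDet (min_le_right (r 0) M) r
        (fun i => (θ.unshare i : Fin (width M r (n + 1) (i.1 : ℕ)) → ℝ)) ≠ 0 at hθ2
      rw [pairDet_eq] at hθ2
      exact requiresShallowChannels_of_det_ne_zero hf hv _ hθ2
  -- Any parameter forces every `r l` to be positive, leaving only `M = 0`, where the bound is `0`.
  · have htriv : ∀ θ : DeepParams M r (n + 1), min (r 0) M ^ 2 ^ n = 0 := by
      intro θ
      have hM : M = 0 := by
        by_contra hM
        exact hpos ⟨Nat.pos_of_ne_zero hM, channels_pos θ⟩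
      simp [hM]
    exact ⟨.of_forall fun θ => by
        rw [htriv θ]
        exact ⟨fun _ _ _ _ => Nat.zero_le _, 1, one_pos, fun _ _ _ _ => Nat.zero_le _⟩,
      .of_forall fun θ => by
        rw [htriv θ.unshare]
        exact ⟨fun _ _ _ _ => Nat.zero_le _, 1, one_pos, fun _ _ _ _ => Nat.zero_le _⟩⟩

end ConvAC

theorem mainTheorem2 (s M L : ℕ) (hL : 1 ≤ L) (r : ℕ → ℕ)
    (f : Fin M → EuclideanSpace ℝ (Fin s) → ℝ)
    (hf_nonneg : ∀ i, ∀ᵐ x, 0 ≤ f i x)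
    (hf_int : ∀ i, Integrable (f i))
    (hf_one : ∀ i, ∫ x, f i x = 1)
    (hf_sq : ∀ i, MemLp (f i) 2)
    (hf_indep : LinearIndependent ℝ fun i => (hf_sq i).toLp (f i)) :
    (∀ μ : Measure (ConvAC.DeepParams M r L), IsProbabilityMeasure μ →
      μ ≪ ConvAC.deepMeasure M r L →
      ∀ᵐ θ ∂μ, ConvAC.RequiresShallowChannels f (ConvAC.htTensor θ)
        (min (r 0) M ^ (2 ^ L / 2))) ∧
    (∀ μ : Measure (ConvAC.SharedParams M r L), IsProbabilityMeasure μ →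
      μ ≪ ConvAC.sharedMeasure M r L →
      ∀ᵐ θ ∂μ, ConvAC.RequiresShallowChannels f (ConvAC.htTensor θ.unshare)
        (min (r 0) M ^ (2 ^ L / 2))) := by
  obtain ⟨n, rfl⟩ := Nat.exists_eq_add_of_le' hL
  have hn : 2 ^ (n + 1) / 2 = 2 ^ n := by have := pow_succ 2 n; omega
  rw [hn]
  obtain ⟨h1, h2⟩ := ConvAC.ae_requiresShallowChannels (n := n) (r := r) hf_sq hf_indep
  exact ⟨fun μ _ hμ => hμ.ae_le h1, fun μ _ hμ => hμ.ae_le h2⟩
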